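/- Let $k$ be a commutative noetherian ring. Let $\mathcal C$ be the category whose objects are the finite sets, in which a morphism from $X$ to $Y$ is a correspondence, that is, a subset of $Y\times X$, and in which the composite of $S\subseteq Y\times X$ followed by $R\subseteq Z\times Y$ is $RS=\{(z,x)\mid \exists\, y\in Y,\ (z,y)\in R \text{ and } (y,x)\in S\}$. Write $\mathcal C(Y,X)$ for the set of morphisms from $X$ to $Y$, and $k\mathcal C(Y,X)$ for the free $k$-module with basis $\mathcal C(Y,X)$. A correspondence functor over $k$ is a functor $M$ from $\mathcal C$ to the category of $k$-modules; for $m\in M(X)$ and $\alpha=\sum_S\lambda_S S\in k\mathcal C(Y,X)$ put $\alpha m=\sum_S\lambda_S M(S)(m)\in M(Y)$. Such an $M$ is generated by a family of elements $m_i\in M(E_i)$, $i\in I$, if for every finite set $X$ every element of $M(X)$ is a finite sum $\sum_{j\in J}\alpha_j m_j$ with $J\subseteq I$ finite and $\alpha_j\in k\mathcal C(X,E_j)$. It is finitely generated if it is generated by such a family with $I$ finite, and it has bounded type if there is a finite set $E$ such that $M$ is generated by (all elements of) $M(E)$. It has a bounded presentation (respectively, is finitely presented) if there is an exact sequence of correspondence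 functors $Q\to P\to M\to 0$ with $P$ and $Q$ projective of bounded type (respectively, projective and finitely generated); exactness means exactness after evaluation at every finite set. Let $N$ be a subfunctor of a correspondence functor $M$ over $k$. (a) If $E$ is a finite set such that $M$ is generated by $M(E)$, and if $F$ is a finite set with $|F|\geq 2^{|E|}$, then $N$ is generated by $N(F)$. (b) If $M$ has bounded type, then $N$ has bounded type. In particular, over $k$, any correspondence functor of bounded type has a bounded presentation. (c) If $M$ is finitely generated, then $N$ is finitely generated. In particular, over $k$, any finitely generated correspondence functor is finitely presented. -/

import Mathlib

open CategoryTheory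

universe u

/-- A finite set, as an object of the category of finite sets and correspondences. -/
structure FinCor : Type (u + 1) where
  carrier : Type u
  [finite : Finite carrier]

namespace FinCor

/-- The category of finite sets and correspondences: a morphism from `X` to `Y` is an arbitrary
subset of `Y × X`, the identity is the diagonal, and the composite of `S ⊆ Y × X` followed by
`R ⊆ Z × Y` is `{(z, x) | ∃ y, (z, y) ∈ R ∧ (y, x) ∈ S}`. -/
instance : Category.{u} FinCor.{u} where
  Hom X Y := Set (Y.carrier × X.carrier)
  id X := {p | p.1 = p.2}
  comp {X Y Z} S R := {p | ∃ y : Y.carrier, (p.1, y) ∈ R ∧ (y, p.2) ∈ S}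
  id_comp S := by
    ext ⟨y, x⟩
    simp
  comp_id S := by
    ext ⟨y, x⟩
    simp
  assoc S R Q := by
    ext ⟨w, x⟩
    constructor
    · rintro ⟨z, hz, y, hy, hx⟩
      exact ⟨y, ⟨z, hz, hy⟩, hx⟩
    · rintro ⟨y, ⟨z, hz, hy⟩, hx⟩
      exact ⟨z, hz, y, hy, hx⟩

end FinCor

/-- Correspondence functors over `k`: functors from finite sets and correspondences to `k`-modules.
Morphisms are the natural transformations. -/
abbrev CorrFunctor (k : Type u) [CommRing k] : Type (u + 1) :=
  FinCor.{u} ⥤ ModuleCat.{u} k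

namespace CorrFunctor

variable {k : Type u} [CommRing k]

/-- The action of a `k`-linear combination `α = ∑ λ_S S` of correspondences from `X` to `Y` on an
element `m ∈ M(X)`, namely `α · m = ∑ λ_S M(S)(m) ∈ M(Y)`. -/
noncomputable def act (M : CorrFunctor k) {X Y : FinCor.{u}} (α : (X ⟶ Y) →₀ k)
    (m : M.obj X) : M.obj Y :=
  α.sum fun S c => c • (M.map S).hom m

/-- `M` is generated by the family of elements `m i ∈ M(E i)`, for `i ∈ I`. -/
def GeneratedBy (M : CorrFunctor k) {I : Type u} (E : I → FinCor.{u})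
    (m : ∀ i, M.obj (E i)) : Prop :=
  ∀ (X : FinCor.{u}) (x : M.obj X),
    ∃ (J : Finset I) (α : ∀ j, (E j ⟶ X) →₀ k), x = ∑ j ∈ J, M.act (α j) (m j)

/-- `M` is generated by `M(E)`. -/
def GeneratedAt (M : CorrFunctor k) (E : FinCor.{u}) : Prop :=
  M.GeneratedBy (I := M.obj E) (fun _ => E) (fun m => m)

/-- `M` is finitely generated: it is generated by a finite family of elements. -/
def FinitelyGenerated (M : CorrFunctor k) : Prop :=
  ∃ (I : Type u) (_ : Finite I) (E : I → FinCor.{u}) (m : ∀ i, M.obj (E i)), M.GeneratedBy E m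

/-- `M` has bounded type: it is generated by `M(E)` for some finite set `E`. -/
def BoundedType (M : CorrFunctor k) : Prop :=
  ∃ E : FinCor.{u}, M.GeneratedAt E

/-- Exactness of `Q ⟶ P ⟶ M ⟶ 0`, which is tested on evaluations at all finite sets. -/
def RightExact {Q P M : CorrFunctor k} (f : Q ⟶ P) (g : P ⟶ M) : Prop :=
  ∀ X : FinCor.{u}, Function.Exact (f.app X).hom (g.app X).hom ∧
    Function.Surjective (g.app X).hom

/-- `M` has a bounded presentation: there is an exact sequence `Q ⟶ P ⟶ M ⟶ 0` with `P` and `Q`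
projective of bounded type. -/
def BoundedPresentation (M : CorrFunctor k) : Prop :=
  ∃ (Q P : CorrFunctor k) (f : Q ⟶ P) (g : P ⟶ M),
    Projective P ∧ Projective Q ∧ P.BoundedType ∧ Q.BoundedType ∧ RightExact f g

/-- `M` is finitely presented: there is an exact sequence `Q ⟶ P ⟶ M ⟶ 0` with `P` and `Q`
projective and finitely generated. -/
def FinitelyPresented (M : CorrFunctor k) : Prop :=
  ∃ (Q P : CorrFunctor k) (f : Q ⟶ P) (g : P ⟶ M),
    Projective P ∧ Projective Q ∧ P.FinitelyGenerated ∧ Q.FinitelyGenerated ∧ RightExact f g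

end CorrFunctor

namespace CorrFunctor

variable {k : Type u} [CommRing k]

/-! For `g : X → F`, the equivalence relation `kerCor g` factors through `F`, so it sends `N(X)`
into the part generated by `N(F)`, and `1 - kerCor g` acts as the identity modulo that part. When
`|F| ≥ 2 ^ |E|`, every `φ : E ⟶ X` is fixed by some `kerCor g`, while each `kerCor g` can only
enlarge correspondences. This triangularity makes a suitable product of operators `1 - kerCor g`
kill all of `M(X)` (`exists_annihilator`), hence `N(X)`; being also the identity modulo the part
generated by `N(F)`, it shows that this part is all of `N(X)`. Noetherianity enters only for finite
generation, through `N(F) ⊆ M(F)`. Presentations come from applying these results to the kernel of a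
free cover. -/

lemma map_comp_hom (M : CorrFunctor k) {X Y Z : FinCor.{u}} (S : X ⟶ Y) (R : Y ⟶ Z)
    (m : M.obj X) : (M.map (S ≫ R)).hom m = (M.map R).hom ((M.map S).hom m) := by
  simp

lemma app_map_hom {M N : CorrFunctor k} (f : N ⟶ M) {X Y : FinCor.{u}} (S : X ⟶ Y)
    (n : N.obj X) :
    (f.app Y).hom ((N.map S).hom n) = (M.map S).hom ((f.app X).hom n) :=
  congrArg (fun φ => φ.hom n) (f.naturality S)

/-- The submodule of `M(X)` of all elements generated by a family of elements `m i ∈ M(E i)`. -/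
def generated (M : CorrFunctor k) {I : Type u} (E : I → FinCor.{u}) (m : ∀ i, M.obj (E i))
    (X : FinCor.{u}) : Submodule k (M.obj X) :=
  Submodule.span k (Set.range fun p : Σ i, E i ⟶ X => (M.map p.2).hom (m p.1))

lemma map_mem_generated (M : CorrFunctor k) {I : Type u} (E : I → FinCor.{u})
    (m : ∀ i, M.obj (E i)) {X : FinCor.{u}} (i : I) (S : E i ⟶ X) :
    (M.map S).hom (m i) ∈ M.generated E m X :=
  Submodule.subset_span ⟨⟨i, S⟩, rfl⟩

lemma mem_generated_iff (M : CorrFunctor k) {I : Type u} (E : I → FinCor.{u})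
    (m : ∀ i, M.obj (E i)) {X : FinCor.{u}} (x : M.obj X) :
    x ∈ M.generated E m X ↔
      ∃ (J : Finset I) (α : ∀ j, (E j ⟶ X) →₀ k), x = ∑ j ∈ J, M.act (α j) (m j) := by
  constructor
  · intro hx
    obtain ⟨c, rfl⟩ := Finsupp.mem_span_range_iff_exists_finsupp.1 hx
    refine ⟨c.splitSupport, c.split, ?_⟩
    rw [Finsupp.sigma_sum]
    rfl
  · rintro ⟨J, α, rfl⟩
    refine Submodule.sum_mem _ fun j _ => Submodule.sum_mem _ fun S _ => ?_
    exact Submodule.smul_mem _ _ (M.map_mem_generated E m j S)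

lemma generatedBy_iff (M : CorrFunctor k) {I : Type u} (E : I → FinCor.{u})
    (m : ∀ i, M.obj (E i)) : M.GeneratedBy E m ↔ ∀ X, M.generated E m X = ⊤ := by
  simp only [GeneratedBy, ← mem_generated_iff, Submodule.eq_top_iff']

lemma generated_le (M : CorrFunctor k) {I I' : Type u} {E : I → FinCor.{u}}
    {m : ∀ i, M.obj (E i)} {E' : I' → FinCor.{u}} {m' : ∀ i, M.obj (E' i)}
    (h : ∀ i, m i ∈ M.generated E' m' (E i)) (X : FinCor.{u}) :
    M.generated E m X ≤ M.generated E' m' X := by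
  refine Submodule.span_le.2 ?_
  rintro _ ⟨⟨i, S⟩, rfl⟩
  have hle : M.generated E' m' (E i) ≤ (M.generated E' m' X).comap (M.map S).hom := by
    refine Submodule.span_le.2 ?_
    rintro _ ⟨⟨j, R⟩, rfl⟩
    change (M.map S).hom ((M.map R).hom (m' j)) ∈ M.generated E' m' X
    rw [← map_comp_hom]
    exact M.map_mem_generated E' m' j (R ≫ S)
  exact hle (h i)

lemma GeneratedBy.of_mem_generated {M : CorrFunctor k} {I I' : Type u} {E : I → FinCor.{u}}
    {m : ∀ i, M.obj (E i)} {E' : I' → FinCor.{u}} {m' : ∀ i, M.obj (E' i)}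
    (hM : M.GeneratedBy E m) (h : ∀ i, m i ∈ M.generated E' m' (E i)) :
    M.GeneratedBy E' m' := by
  rw [generatedBy_iff] at hM ⊢
  exact fun X => top_le_iff.1 ((hM X).ge.trans (M.generated_le h X))

lemma app_injective {M N : CorrFunctor k} (ι : N ⟶ M) [Mono ι] (X : FinCor.{u}) :
    Function.Injective (ι.app X).hom :=
  (ModuleCat.mono_iff_injective _).1 inferInstance

/-! ### Subfunctors of functors of bounded type -/

/-- The correspondence on `X` relating the points with the same image under `g`. -/
def kerCor {X F : FinCor.{u}} (g : X.carrier → F.carrier) : X ⟶ X :=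
  ({p | g p.1 = g p.2} : Set (X.carrier × X.carrier))

/-- The graph of a map, as a correspondence. -/
def graph {X F : FinCor.{u}} (g : X.carrier → F.carrier) : X ⟶ F :=
  ({p | p.1 = g p.2} : Set (F.carrier × X.carrier))

/-- The opposite of the graph of a map, as a correspondence. -/
def graphOp {X F : FinCor.{u}} (g : X.carrier → F.carrier) : F ⟶ X :=
  ({p | p.2 = g p.1} : Set (X.carrier × F.carrier))

lemma graph_comp_graphOp {X F : FinCor.{u}} (g : X.carrier → F.carrier) :
    graph g ≫ graphOp g = kerCor g := by
  apply Set.ext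
  rintro ⟨y, x⟩
  constructor
  · rintro ⟨f, h₁, h₂⟩
    exact h₁.symm.trans h₂
  · intro h
    exact ⟨g y, rfl, h⟩

lemma kerCor_eq_id {X F : FinCor.{u}} {g : X.carrier → F.carrier} (hg : Function.Injective g) :
    kerCor g = 𝟙 X := by
  apply Set.ext
  rintro ⟨y, x⟩
  exact hg.eq_iff

/-- A correspondence from `E` to `X`, as an element of the lattice of subsets of `X × E`. -/
def toSet {E X : FinCor.{u}} (φ : E ⟶ X) : Set (X.carrier × E.carrier) := φ

lemma toSet_le_comp_kerCor {E X F : FinCor.{u}} (g : X.carrier → F.carrier) (φ : E ⟶ X) :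
    toSet φ ≤ toSet (φ ≫ kerCor g) := by
  rintro ⟨x, a⟩ h
  exact ⟨x, rfl, h⟩

/-- If `F` has at least as many elements as there are subsets of `E`, every correspondence from
`E` to `X` is fixed by some `kerCor g` with `g` a map from `X` to `F`. -/
lemma exists_comp_kerCor_eq {E F X : FinCor.{u}} (e : Set E.carrier ↪ F.carrier) (φ : E ⟶ X) :
    ∃ g : X.carrier → F.carrier, φ ≫ kerCor g = φ := by
  -- `g` encodes the row of `φ` at `x`, so it identifies only points with equal rows.
  refine ⟨fun x => e {a | (x, a) ∈ toSet φ}, ?_⟩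
  apply Set.ext
  rintro ⟨y, a⟩
  constructor
  · rintro ⟨x, h₁, h₂⟩
    have h : {a | (y, a) ∈ toSet φ} = {a | (x, a) ∈ toSet φ} := e.injective h₁
    exact (Set.ext_iff.1 h a).2 h₂
  · intro h
    exact ⟨y, rfl, h⟩

/-- The factorization of `kerCor g` through `F` expresses the element as the image of an element of
`N(F)`. -/
lemma kerCor_mem_generated (N : CorrFunctor k) {X F : FinCor.{u}} (g : X.carrier → F.carrier)
    (x : N.obj X) :
    (N.map (kerCor g)).hom x ∈ N.generated (I := N.obj F) (fun _ => F) (fun n => n) X := by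
  rw [← graph_comp_graphOp, map_comp_hom]
  exact N.map_mem_generated (I := N.obj F) (fun _ => F) (fun n => n) _ (graphOp g)

/-- For an upper set `U` of correspondences from `E` to `X`, a suitable product of operators
`1 - kerCor g` annihilates all elements coming from `M(E)` through `U`. -/
lemma exists_annihilator {M N : CorrFunctor k} (ι : N ⟶ M) {E F : FinCor.{u}}
    (e : Set E.carrier ↪ F.carrier) (X : FinCor.{u}) (U : Set (Set (X.carrier × E.carrier)))
    (hU : IsUpperSet U) :
    ∃ (b : N.obj X →ₗ[k] N.obj X) (c : M.obj X →ₗ[k] M.obj X),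
      (∀ x, (ι.app X).hom (b x) = c ((ι.app X).hom x)) ∧
      (∀ x, x - b x ∈ N.generated (I := N.obj F) (fun _ => F) (fun n => n) X) ∧
      ∀ (φ : E ⟶ X) (m : M.obj E), toSet φ ∈ U → c ((M.map φ).hom m) = 0 := by
  have := X.finite
  have := E.finite
  induction hn : U.ncard using Nat.strong_induction_on generalizing U with
  | _ n ih =>
    obtain rfl | hne := U.eq_empty_or_nonempty
    · exact ⟨LinearMap.id, LinearMap.id, fun _ => rfl, fun x => by simp, fun _ _ h => h.elim⟩
    -- Removing a minimal element leaves an upper set, so induction applies to `U \ {φ₀}`.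
    obtain ⟨φ₀, hφ₀⟩ := U.toFinite.exists_minimal hne
    obtain ⟨b, c, hbc, hb, hc⟩ := ih (U \ {φ₀}).ncard
      (hn ▸ Set.ncard_sdiff_singleton_lt_of_mem hφ₀.1) (U \ {φ₀})
      (fun s t hst hs => ⟨hU hst hs.1, fun h => hs.2 (by
        obtain rfl : t = φ₀ := h
        exact le_antisymm hst (hφ₀.2 hs.1 hst))⟩) rfl
    obtain ⟨g, hg⟩ := exists_comp_kerCor_eq (X := X) e φ₀
    -- The new factor acts first: it kills `φ₀` and sends any other `φ ∈ U` to a difference of two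
    -- elements of `U \ {φ₀}`.
    refine ⟨b ∘ₗ (LinearMap.id - (N.map (kerCor g)).hom),
      c ∘ₗ (LinearMap.id - (M.map (kerCor g)).hom), fun x => ?_, fun x => ?_, fun φ m hφ => ?_⟩
    · simp only [LinearMap.comp_apply, LinearMap.sub_apply, LinearMap.id_apply, hbc, map_sub,
        app_map_hom]
    · have h := Submodule.add_mem _ (hb (x - (N.map (kerCor g)).hom x))
        (N.kerCor_mem_generated g x)
      rw [LinearMap.comp_apply, LinearMap.sub_apply, LinearMap.id_apply]
      convert h using 1
      abel
    · rw [LinearMap.comp_apply, LinearMap.sub_apply, LinearMap.id_apply, ← map_comp_hom]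
      by_cases h : toSet φ = φ₀
      · have h' : φ ≫ kerCor g = φ := by
          obtain rfl : φ = φ₀ := h
          exact hg
        rw [h', sub_self, map_zero]
      · have hle := toSet_le_comp_kerCor g φ
        -- If `φ ≫ kerCor g` were `φ₀`, then `φ ≤ φ₀`, and minimality would force `φ = φ₀`.
        rw [map_sub, hc φ m ⟨hφ, h⟩, hc (φ ≫ kerCor g) m ⟨hU hle hφ, fun h' => h ?_⟩, sub_self]
        obtain h' : toSet (φ ≫ kerCor g) = φ₀ := h'
        exact le_antisymm (h' ▸ hle) (hφ₀.2 hφ (h' ▸ hle))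

theorem GeneratedAt.of_mono {M N : CorrFunctor k} (ι : N ⟶ M) [Mono ι] {E F : FinCor.{u}}
    (hM : M.GeneratedAt E) (h : 2 ^ Nat.card E.carrier ≤ Nat.card F.carrier) :
    N.GeneratedAt F := by
  have := E.finite
  have := F.finite
  have := Fintype.ofFinite E.carrier
  have := Fintype.ofFinite F.carrier
  obtain ⟨e⟩ : Nonempty (Set E.carrier ↪ F.carrier) :=
    Function.Embedding.nonempty_of_card_le (by simpa using h)
  unfold GeneratedAt at hM ⊢
  rw [generatedBy_iff] at hM ⊢
  refine fun X => Submodule.eq_top_iff'.2 fun x => ?_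
  obtain ⟨b, c, hbc, hb, hc⟩ := exists_annihilator ι e X Set.univ isUpperSet_univ
  have hc0 : M.generated (I := M.obj E) (fun _ => E) (fun m => m) X ≤ LinearMap.ker c := by
    refine Submodule.span_le.2 ?_
    rintro _ ⟨⟨m, φ⟩, rfl⟩
    exact hc φ m trivial
  have hb0 : b x = 0 := by
    apply app_injective ι X
    rw [hbc, map_zero]
    exact hc0 (hM X ▸ Submodule.mem_top)
  simpa [hb0] using hb x

/-- The set of subsets of a finite set. -/
def powerset (E : FinCor.{u}) : FinCor.{u} :=
  have := E.finite
  ⟨Set E.carrier⟩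

lemma card_powerset (E : FinCor.{u}) :
    Nat.card (powerset E).carrier = 2 ^ Nat.card E.carrier := by
  have := E.finite
  have := Fintype.ofFinite E.carrier
  change Nat.card (Set E.carrier) = _
  rw [Nat.card_eq_fintype_card, Fintype.card_set, ← Nat.card_eq_fintype_card]

theorem BoundedType.of_mono {M N : CorrFunctor k} (ι : N ⟶ M) [Mono ι] (hM : M.BoundedType) :
    N.BoundedType := by
  obtain ⟨E, hE⟩ := hM
  exact ⟨powerset E, hE.of_mono ι (card_powerset E).ge⟩

/-! ### Finite generation -/

/-- Each `E i` embeds in the disjoint union of all of them, so its identity, being `kerCor` of an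
injection, factors through that union. -/
lemma FinitelyGenerated.boundedType {M : CorrFunctor k} (hM : M.FinitelyGenerated) :
    M.BoundedType := by
  obtain ⟨I, _, E, m, h⟩ := hM
  have := fun i => (E i).finite
  refine ⟨⟨Σ i, (E i).carrier⟩, h.of_mem_generated fun i => ?_⟩
  let g : (E i).carrier → (⟨Σ i, (E i).carrier⟩ : FinCor.{u}).carrier := fun a => ⟨i, a⟩
  have hg : Function.Injective g :=
    sigma_mk_injective (β := fun i => (E i).carrier)
  have hm := M.kerCor_mem_generated g (m i)
  rw [kerCor_eq_id hg] at hm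
  simpa using hm

lemma FinitelyGenerated.fg_obj {M : CorrFunctor k} (hM : M.FinitelyGenerated) (X : FinCor.{u}) :
    Module.Finite k (M.obj X) := by
  obtain ⟨I, _, E, m, h⟩ := hM
  have hfin : ∀ i, Finite (E i ⟶ X) := fun i => by
    have := (E i).finite
    have := X.finite
    exact inferInstanceAs (Finite (Set (X.carrier × (E i).carrier)))
  rw [generatedBy_iff] at h
  exact ⟨h X ▸ Submodule.fg_span (Set.finite_range _)⟩

lemma GeneratedAt.finitelyGenerated {M : CorrFunctor k} {E : FinCor.{u}} (hM : M.GeneratedAt E)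
    [Module.Finite k (M.obj E)] : M.FinitelyGenerated := by
  obtain ⟨s, hs⟩ := Module.Finite.fg_top (R := k) (M := M.obj E)
  refine ⟨s, inferInstance, fun _ => E, fun i => i.1, hM.of_mem_generated fun m => ?_⟩
  have hle : Submodule.span k (s : Set (M.obj E)) ≤
      M.generated (I := s) (fun _ => E) (fun i => i.1) E := by
    refine Submodule.span_le.2 fun x hx => ?_
    simpa using M.map_mem_generated (I := s) (fun _ => E) (fun i => i.1) ⟨x, hx⟩ (𝟙 E)
  exact hle (hs ▸ Submodule.mem_top)

/-- `N` is generated by some `N(F)`, which is a submodule of the noetherian module `M(F)`. -/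
theorem FinitelyGenerated.of_mono [IsNoetherianRing k] {M N : CorrFunctor k} (ι : N ⟶ M) [Mono ι]
    (hM : M.FinitelyGenerated) : N.FinitelyGenerated := by
  obtain ⟨F, hF⟩ := hM.boundedType.of_mono ι
  have := hM.fg_obj F
  have : Module.Finite k (N.obj F) := Module.Finite.of_injective (ι.app F).hom (app_injective ι F)
  exact hF.finitelyGenerated

/-! ### Free functors -/

/-- The direct sum of the representable functors `k𝒞(-, E i)`. -/
noncomputable def free (k : Type u) [CommRing k] {I : Type u} (E : I → FinCor.{u}) :
    CorrFunctor k where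
  obj X := ModuleCat.of k ((Σ i, E i ⟶ X) →₀ k)
  map S := ModuleCat.ofHom (Finsupp.lmapDomain k k fun p => ⟨p.1, p.2 ≫ S⟩)
  map_id X := by
    ext : 1
    simp only [Category.comp_id, ModuleCat.hom_ofHom, ModuleCat.hom_id]
    exact Finsupp.lmapDomain_id k k
  map_comp S R := by
    ext : 1
    simp only [← Category.assoc, ModuleCat.hom_ofHom, ModuleCat.hom_comp]
    exact Finsupp.lmapDomain_comp k k
      (fun p : Σ i, E i ⟶ _ => (⟨p.1, p.2 ≫ S⟩ : Σ i, E i ⟶ _))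
      (fun p => (⟨p.1, p.2 ≫ R⟩ : Σ i, E i ⟶ _))

/-- The canonical generators of a free functor. -/
noncomputable def freeGen (k : Type u) [CommRing k] {I : Type u} (E : I → FinCor.{u}) (i : I) :
    (free k E).obj (E i) :=
  Finsupp.single (⟨i, 𝟙 (E i)⟩ : Σ j, E j ⟶ E i) (1 : k)

lemma free_map_freeGen {I : Type u} (E : I → FinCor.{u}) {X : FinCor.{u}} (i : I) (S : E i ⟶ X) :
    ((free k E).map S).hom (freeGen k E i) =
      Finsupp.single (⟨i, S⟩ : Σ j, E j ⟶ X) (1 : k) := by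
  refine (Finsupp.mapDomain_single (f := fun p : Σ j, E j ⟶ E i =>
    (⟨p.1, p.2 ≫ S⟩ : Σ j, E j ⟶ X))).trans ?_
  simp

lemma free_generatedBy {I : Type u} (E : I → FinCor.{u}) :
    (free k E).GeneratedBy E (freeGen k E) := by
  rw [generatedBy_iff]
  intro X
  simp only [generated, free_map_freeGen]
  have h : (Submodule.span k (Set.range (Finsupp.basisSingleOne (R := k)
    (ι := Σ j, E j ⟶ X)))) = ⊤ := Module.Basis.span_eq _
  rw [Finsupp.coe_basisSingleOne] at h
  exact h

/-- The morphism from a free functor determined by the images of the generators. -/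
noncomputable def freeDesc (M : CorrFunctor k) {I : Type u} (E : I → FinCor.{u})
    (m : ∀ i, M.obj (E i)) : free k E ⟶ M where
  app X := ModuleCat.ofHom (Finsupp.linearCombination k
    fun p : Σ i, E i ⟶ X => (M.map p.2).hom (m p.1))
  naturality X Y S := by
    ext : 1
    refine Finsupp.lhom_ext' fun p => LinearMap.ext_ring ?_
    change Finsupp.linearCombination k _ (Finsupp.mapDomain _ (Finsupp.single p 1)) =
      (M.map S).hom (Finsupp.linearCombination k _ (Finsupp.single p 1))
    rw [Finsupp.mapDomain_single, Finsupp.linearCombination_single,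
      Finsupp.linearCombination_single, one_smul, one_smul, map_comp_hom]

lemma freeDesc_freeGen (M : CorrFunctor k) {I : Type u} (E : I → FinCor.{u})
    (m : ∀ i, M.obj (E i)) (i : I) :
    ((freeDesc M E m).app (E i)).hom (freeGen k E i) = m i := by
  refine (Finsupp.linearCombination_single k (1 : k)
    (⟨i, 𝟙 (E i)⟩ : Σ j, E j ⟶ E i)).trans ?_
  simp

lemma free_hom_ext {M : CorrFunctor k} {I : Type u} {E : I → FinCor.{u}} {f g : free k E ⟶ M}
    (h : ∀ i, (f.app (E i)).hom (freeGen k E i) = (g.app (E i)).hom (freeGen k E i)) : f = g := by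
  ext X : 3
  refine Finsupp.lhom_ext' fun p => LinearMap.ext_ring ?_
  change (f.app X).hom (Finsupp.single (⟨p.1, p.2⟩ : Σ j, E j ⟶ X) (1 : k)) =
    (g.app X).hom (Finsupp.single (⟨p.1, p.2⟩ : Σ j, E j ⟶ X) (1 : k))
  rw [← free_map_freeGen, app_map_hom, app_map_hom, h]

instance free_projective {I : Type u} (E : I → FinCor.{u}) : Projective (free k E) where
  factors {A B} f e _ := by
    have hs : ∀ X, Function.Surjective (e.app X).hom := fun X =>
      (ModuleCat.epi_iff_surjective _).1 inferInstance
    choose a ha using fun i => hs (E i) ((f.app (E i)).hom (freeGen k E i))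
    refine ⟨freeDesc A E a, free_hom_ext fun i => ?_⟩
    rw [← ha i]
    simp only [NatTrans.comp_app, ModuleCat.hom_comp, LinearMap.comp_apply, freeDesc_freeGen]

lemma freeDesc_surjective {M : CorrFunctor k} {I : Type u} {E : I → FinCor.{u}}
    {m : ∀ i, M.obj (E i)} (h : M.GeneratedBy E m) (X : FinCor.{u}) :
    Function.Surjective ((freeDesc M E m).app X).hom := by
  rw [generatedBy_iff] at h
  rw [← LinearMap.range_eq_top, ← h X]
  exact Finsupp.range_linearCombination k

/-- `I` may be infinite: bounded type limits the size of `E`, not the number of generators. -/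
lemma free_generatedAt {I : Type u} (E : FinCor.{u}) :
    (free k fun _ : I => E).GeneratedAt E :=
  (free_generatedBy _).of_mem_generated fun i => by
    simpa using map_mem_generated (free k fun _ : I => E)
      (I := (free k fun _ : I => E).obj E) (fun _ => E) (fun m => m) (freeGen k _ i) (𝟙 E)

/-! ### Presentations -/

/-- The kernel of a morphism of correspondence functors. -/
noncomputable def ker {P M : CorrFunctor k} (g : P ⟶ M) : CorrFunctor k where
  obj X := ModuleCat.of k (LinearMap.ker (g.app X).hom)
  map S := ModuleCat.ofHom ((P.map S).hom.restrict fun x hx => by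
    rw [LinearMap.mem_ker] at hx ⊢
    rw [app_map_hom, hx, map_zero])
  map_id X := by
    ext x
    exact congrArg (fun φ => φ.hom x.1) (P.map_id X)
  map_comp S R := by
    ext x
    exact P.map_comp_hom S R x.1

/-- The inclusion of the kernel of a morphism of correspondence functors. -/
noncomputable def kerι {P M : CorrFunctor k} (g : P ⟶ M) : ker g ⟶ P where
  app X := ModuleCat.ofHom (LinearMap.ker (g.app X).hom).subtype

instance kerι_mono {P M : CorrFunctor k} (g : P ⟶ M) : Mono (kerι g) :=
  have : ∀ X, Mono ((kerι g).app X) := fun X =>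
    (ModuleCat.mono_iff_injective _).2 (LinearMap.ker (g.app X).hom).injective_subtype
  NatTrans.mono_of_mono_app _

lemma rightExact_comp_kerι {Q P M : CorrFunctor k} (q : Q ⟶ P) (g : P ⟶ M) (f : Q ⟶ ker g)
    (hq : q = f ≫ kerι g) (hf : ∀ X, Function.Surjective (f.app X).hom)
    (hg : ∀ X, Function.Surjective (g.app X).hom) : RightExact q g := by
  subst hq
  refine fun X => ⟨fun y => ⟨fun hy => ?_, ?_⟩, hg X⟩
  · obtain ⟨x, hx⟩ := hf X ⟨y, hy⟩
    exact ⟨x, congrArg Subtype.val hx⟩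
  · rintro ⟨x, rfl⟩
    exact ((f.app X).hom x).2

theorem BoundedType.boundedPresentation {M : CorrFunctor k} (hM : M.BoundedType) :
    M.BoundedPresentation := by
  obtain ⟨E, hE⟩ := hM
  have hP : (free k fun _ : M.obj E => E).BoundedType := ⟨E, free_generatedAt E⟩
  -- The relations form a subfunctor of a functor of bounded type, so a second free functor covers
  -- them.
  obtain ⟨F, hF⟩ := hP.of_mono (kerι (freeDesc M _ fun m => m))
  exact ⟨_, _, freeDesc _ _ (fun n => n) ≫ kerι _, freeDesc M _ fun m => m, inferInstance,
    free_projective _, hP, ⟨F, free_generatedAt F⟩,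
    rightExact_comp_kerι _ _ _ rfl (freeDesc_surjective hF) (freeDesc_surjective hE)⟩

theorem FinitelyGenerated.finitelyPresented [IsNoetherianRing k] {M : CorrFunctor k}
    (hM : M.FinitelyGenerated) : M.FinitelyPresented := by
  obtain ⟨I, hI, E, m, h⟩ := hM
  have hP : (free k E).FinitelyGenerated := ⟨I, hI, E, _, free_generatedBy E⟩
  obtain ⟨J, hJ, F, n, h'⟩ := hP.of_mono (kerι (freeDesc M E m))
  exact ⟨free k F, free k E, freeDesc _ F n ≫ kerι _, freeDesc M E m, inferInstance,
    inferInstance, hP, ⟨J, hJ, F, _, free_generatedBy F⟩,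
    rightExact_comp_kerι _ _ _ rfl (freeDesc_surjective h') (freeDesc_surjective h)⟩

end CorrFunctor

theorem mainTheorem5 (k : Type u) [CommRing k] [IsNoetherianRing k] :
    (∀ (M N : CorrFunctor k) (ι : N ⟶ M), Mono ι →
      (∀ E F : FinCor.{u}, M.GeneratedAt E → 2 ^ Nat.card E.carrier ≤ Nat.card F.carrier →
        N.GeneratedAt F) ∧
      (M.BoundedType → N.BoundedType) ∧
      (M.FinitelyGenerated → N.FinitelyGenerated)) ∧
    (∀ M : CorrFunctor k, M.BoundedType → M.BoundedPresentation) ∧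
    (∀ M : CorrFunctor k, M.FinitelyGenerated → M.FinitelyPresented) :=
  ⟨fun _ _ ι _ => ⟨fun _ _ hE hF => hE.of_mono ι hF, fun h => h.of_mono ι,
    fun h => h.of_mono ι⟩, fun _ h => h.boundedPresentation, fun _ h => h.finitelyPresented⟩
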